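/- Let $N\ge 0$ and let $X$ be a compact, connected smooth ($C^\infty$) manifold of dimension $N$ (Hausdorff and without boundary). Let $G$ be a finite group acting smoothly on $X$, and assume that the action is free, i.e. every orbit $\{g.x : g\in G\}$, $x\in X$, has exactly $\#(G)$ elements. Let $G$ also act on $\mathbb{R}^N$ by linear isometries (of the Euclidean norm). A map $F:X\to\mathbb{R}^N$ is called $G$-equivariant if $F(g.x)=g.F(x)$ for all $x\in X$ and $g\in G$. Assume that there exists a $G$-equivariant $C^\infty$-smooth function $f:X\to\mathbb{R}^N$ such that $0$ is a regular value of $f$ (the differential of $f$ is surjective at every point of $f^{-1}(0)$) and such that $f^{-1}(0)=\{g.x_0 : g\in G\}$ for some $x_0\in X$. Then every $G$-equivariant continuous function $h:X\to\mathbb{R}^N$ vanishes at some point of $X$. -/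

import Mathlib

open scoped Manifold ContDiff

/-- A point `y` of a normed space is a regular value of a map `f` from a manifold `X` (modelled
on `I`): the differential of `f` is surjective at every point of the fibre `f ⁻¹' {y}`.
It is meant for smooth `f`; values that are not attained are regular. -/
def IsRegularValue {E H X F : Type*} [NormedAddCommGroup E] [NormedSpace ℝ E]
    [TopologicalSpace H] (I : ModelWithCorners ℝ E H) [TopologicalSpace X] [ChartedSpace H X]
    [NormedAddCommGroup F] [NormedSpace ℝ F] (f : X → F) (y : F) : Prop :=
  ∀ x : X, f x = y → Function.Surjective (mfderiv I 𝓘(ℝ, F) f x)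

/-- A function `F : X → V` is equivariant for an action of `G` on `X` and
an action `ρ` of `G` on `V` by linear isometries. -/
def IsEquivariant {G X V : Type*} [Group G] [MulAction G X] [NormedAddCommGroup V]
    [NormedSpace ℝ V] (ρ : G →* (V ≃ₗᵢ[ℝ] V)) (F : X → V) : Prop :=
  ∀ (g : G) (x : X), F (g • x) = ρ g (F x)

/-! The number of zeros, taken modulo `2 * Nat.card G`, survives equivariant deformation. For `f` it
is the size of one free orbit, `Nat.card G`. If `h` had no zero, compactness would bound `‖h‖`
below, and a map close enough to `h`, obtained from `f` by admissible deformations, would have no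
zeros at all. This would make `Nat.card G` divisible by its double.

The deformations are local (`exists_equivariant_modification`). On a small open set disjoint from
its translates by nontrivial elements, the current map is interpolated towards a constant `c` near
`h`, and the change is copied to the translates by equivariance. A Sard argument chooses `c` so that
zeros stay nondegenerate. The zero count then changes by `Nat.card G` times the change in one chart,
which has to be even. Finitely many such moves cover `X`, and none spoils closeness to `h` achieved
earlier.

Evenness is mod 2 degree theory in Euclidean space, obtained by integration. For `φ` concentrated
near `0`, `∫ φ(A) det DA` is the signed count of zeros times `∫ φ`, and it is unaffected by changes
of `A` on a compact set because Jacobian determinants have a divergence structure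
(`integral_det_updateRow_partials`). Signs are `±1`, so the parity of the count is determined. -/

open MeasureTheory Set Filter Topology

/-! ### Jacobian determinants as null Lagrangians -/

section Jacobian

variable {N : ℕ}

local notation "𝔼" => EuclideanSpace ℝ (Fin N)

/-- The vector of partial derivatives of a real function on Euclidean space. -/
noncomputable def partials (u : 𝔼 → ℝ) (x : 𝔼) : Fin N → ℝ :=
  fun j => fderiv ℝ u x (EuclideanSpace.single j 1)

/-- The Jacobian matrix of a self-map of Euclidean space; its rows are the partial derivatives of
the components. -/
noncomputable def jacobian (F : 𝔼 → 𝔼) (x : 𝔼) : Matrix (Fin N) (Fin N) ℝ :=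
  Matrix.of fun k => partials (fun y => F y k) x

theorem hasFDerivAt_component {F : 𝔼 → 𝔼} {F' : 𝔼 →L[ℝ] 𝔼} {x : 𝔼} (h : HasFDerivAt F F' x)
    (k : Fin N) : HasFDerivAt (fun y => F y k) ((EuclideanSpace.proj k).comp F') x :=
  (EuclideanSpace.proj (𝕜 := ℝ) k).hasFDerivAt.comp x h

theorem ContDiff.component {F : 𝔼 → 𝔼} {n : WithTop ℕ∞} (h : ContDiff ℝ n F) (k : Fin N) :
    ContDiff ℝ n (fun y => F y k) :=
  (EuclideanSpace.proj (𝕜 := ℝ) k).contDiff.comp h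

theorem det_fderiv_eq_det_jacobian {F : 𝔼 → 𝔼} {x : 𝔼} (h : DifferentiableAt ℝ F x) :
    (fderiv ℝ F x).det = (jacobian F x).det := by
  rw [ContinuousLinearMap.det,
    ← LinearMap.det_toMatrix (EuclideanSpace.basisFun (Fin N) ℝ).toBasis]
  congr 1
  ext k j
  simp [LinearMap.toMatrix_apply, jacobian, partials,
    (hasFDerivAt_component h.hasFDerivAt k).fderiv]

theorem contDiff_partials {u : 𝔼 → ℝ} {m n : WithTop ℕ∞} (h : ContDiff ℝ n u) (hmn : m + 1 ≤ n)
    (j : Fin N) : ContDiff ℝ m (fun x => partials u x j) :=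
  (h.fderiv_right hmn).clm_apply contDiff_const

theorem partials_partials_comm {u : 𝔼 → ℝ} (h : ContDiff ℝ 2 u) (i j : Fin N) (x : 𝔼) :
    partials (fun y => partials u y i) x j = partials (fun y => partials u y j) x i := by
  have hd : DifferentiableAt ℝ (fderiv ℝ u) x :=
    (h.fderiv_right (m := 1) (by norm_num)).differentiable (by norm_num) x
  have key : ∀ i j : Fin N, partials (fun y => partials u y i) x j =
      fderiv ℝ (fderiv ℝ u) x (EuclideanSpace.single j 1) (EuclideanSpace.single i 1) := by
    intro i j
    unfold partials
    rw [(hd.hasFDerivAt.clm_apply (hasFDerivAt_const _ x)).fderiv]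
    simp
  rw [key, key]
  exact (h.contDiffAt.isSymmSndFDerivAt (by simp)) _ _

theorem partials_prod {ι : Type*} [DecidableEq ι] (s : Finset ι) {g : ι → 𝔼 → ℝ} {x : 𝔼}
    (hg : ∀ i ∈ s, DifferentiableAt ℝ (g i) x) (j : Fin N) :
    partials (fun y => ∏ i ∈ s, g i y) x j
      = ∑ i ∈ s, (∏ l ∈ s.erase i, g l x) * partials (g i) x j := by
  unfold partials
  rw [(HasFDerivAt.finsetProd fun i hi => (hg i hi).hasFDerivAt).fderiv]
  simp

theorem integral_mul_partials {u v : 𝔼 → ℝ} (hu : ContDiff ℝ 1 u) (hv : ContDiff ℝ 1 v)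
    (hc : HasCompactSupport v) (j : Fin N) :
    ∫ x, u x * partials v x j = - ∫ x, partials u x j * v x := by
  have h1 : Continuous fun x => partials u x j :=
    (contDiff_partials (m := 0) hu (by norm_num) j).continuous
  have h2 : Continuous fun x => partials v x j :=
    (contDiff_partials (m := 0) hv (by norm_num) j).continuous
  have h3 : HasCompactSupport fun x => partials v x j :=
    (hc.fderiv ℝ).comp_left (g := fun L : 𝔼 →L[ℝ] ℝ => L (EuclideanSpace.single j 1)) rfl
  refine integral_mul_fderiv_eq_neg_fderiv_mul_of_integrable ?_ ?_ ?_
    (fun x _ => hu.differentiable (by norm_num) x) (fun x _ => hv.differentiable (by norm_num) x)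
  · exact (h1.mul hv.continuous).integrable_of_hasCompactSupport hc.mul_left
  · exact (hu.continuous.mul h2).integrable_of_hasCompactSupport h3.mul_left
  · exact (hu.continuous.mul hv.continuous).integrable_of_hasCompactSupport hc.mul_left

/-- A Jacobian determinant with one row replaced by the gradient of a compactly supported function
has integral zero. -/
theorem integral_det_updateRow_partials {F : 𝔼 → 𝔼} (hF : ContDiff ℝ 2 F) {w : 𝔼 → ℝ}
    (hw : ContDiff ℝ 1 w) (hc : HasCompactSupport w) (i : Fin N) :
    ∫ x, ((jacobian F x).updateRow i (partials w x)).det = 0 := by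
  set d : Fin N → Fin N → 𝔼 → ℝ := fun k j x => partials (fun y => F y k) x j with hd
  have hd1 : ∀ k j, ContDiff ℝ 1 (d k j) := fun k j =>
    contDiff_partials (hF.component k) (by norm_num) j
  set P : Equiv.Perm (Fin N) → 𝔼 → ℝ := fun σ x => ∏ k ∈ Finset.univ.erase i, d k (σ k) x with hP
  have hP1 : ∀ σ, ContDiff ℝ 1 (P σ) := fun σ => contDiff_prod fun k _ => hd1 k (σ k)
  have hwp : ∀ j, Continuous fun x => partials w x j := fun j =>
    (contDiff_partials (m := 0) hw (by norm_num) j).continuous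
  have hPp : ∀ σ j, Continuous fun x => partials (P σ) x j := fun σ j =>
    (contDiff_partials (m := 0) (hP1 σ) (by norm_num) j).continuous
  have hwc : ∀ j, HasCompactSupport fun x => partials w x j := fun j =>
    (hc.fderiv ℝ).comp_left (g := fun L : 𝔼 →L[ℝ] ℝ => L (EuclideanSpace.single j 1)) rfl
  have hdet : ∀ x, ((jacobian F x).updateRow i (partials w x)).det
      = ∑ σ : Equiv.Perm (Fin N), (Equiv.Perm.sign σ : ℝ) * (P σ x * partials w x (σ i)) := by
    intro x
    rw [← Matrix.det_transpose, Matrix.det_apply']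
    refine Finset.sum_congr rfl fun σ _ => ?_
    congr 1
    rw [← Finset.prod_erase_mul _ _ (Finset.mem_univ i)]
    congr 1
    · refine Finset.prod_congr rfl fun k hk => ?_
      rw [Matrix.transpose_apply, Matrix.updateRow_ne (Finset.ne_of_mem_erase hk)]
      rfl
    · simp
  -- The cofactors of row `i` form a divergence-free field. After the product rule, composing `σ`
  -- with the transposition of `i` and `k` flips the sign but preserves the term, by symmetry of
  -- second derivatives.
  have hzero : ∀ x, ∑ σ : Equiv.Perm (Fin N), (Equiv.Perm.sign σ : ℝ) * partials (P σ) x (σ i)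
      = 0 := by
    intro x
    have h1 : ∀ σ : Equiv.Perm (Fin N), (Equiv.Perm.sign σ : ℝ) * partials (P σ) x (σ i)
        = ∑ k ∈ Finset.univ.erase i, (Equiv.Perm.sign σ : ℝ) *
          ((∏ l ∈ (Finset.univ.erase i).erase k, d l (σ l) x) * partials (d k (σ k)) x (σ i)) := by
      intro σ
      rw [hP, partials_prod _ (fun k _ => (hd1 k (σ k)).differentiable (by norm_num) x),
        Finset.mul_sum]
    simp_rw [h1]
    rw [Finset.sum_comm]
    refine Finset.sum_eq_zero fun k hk => ?_
    have hki : k ≠ i := Finset.ne_of_mem_erase hk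
    set T : Equiv.Perm (Fin N) → ℝ := fun σ => (Equiv.Perm.sign σ : ℝ) *
      ((∏ l ∈ (Finset.univ.erase i).erase k, d l (σ l) x) * partials (d k (σ k)) x (σ i)) with hT
    have hanti : ∀ σ, T (σ * Equiv.swap i k) = - T σ := by
      intro σ
      have hprod : ∏ l ∈ (Finset.univ.erase i).erase k, d l ((σ * Equiv.swap i k) l) x
          = ∏ l ∈ (Finset.univ.erase i).erase k, d l (σ l) x := by
        refine Finset.prod_congr rfl fun l hl => ?_
        rw [Equiv.Perm.mul_apply, Equiv.swap_apply_of_ne_of_ne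
          (Finset.ne_of_mem_erase (Finset.mem_of_mem_erase hl)) (Finset.ne_of_mem_erase hl)]
      simp only [hT]
      rw [hprod, Equiv.Perm.sign_mul, Equiv.Perm.sign_swap hki.symm, Equiv.Perm.mul_apply,
        Equiv.Perm.mul_apply, Equiv.swap_apply_left, Equiv.swap_apply_right, hd]
      dsimp only
      rw [partials_partials_comm (hF.component k)]
      push_cast
      ring
    have hsum : ∑ σ, T (σ * Equiv.swap i k) = ∑ σ, T σ :=
      Equiv.sum_comp (Equiv.mulRight (Equiv.swap i k)) T
    simp_rw [hanti, Finset.sum_neg_distrib] at hsum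
    change ∑ σ, T σ = 0
    linarith
  simp_rw [hdet]
  rw [integral_finsetSum _ fun σ _ => ?_]
  · simp_rw [integral_const_mul, integral_mul_partials (hP1 _) hw hc, mul_neg,
      ← integral_const_mul]
    rw [Finset.sum_neg_distrib, ← integral_finsetSum _ fun σ _ => ?_]
    · simp_rw [← mul_assoc, ← Finset.sum_mul, hzero]
      simp
    · exact (((hPp σ _).mul hw.continuous).integrable_of_hasCompactSupport
        hc.mul_left).const_mul _
  · exact (((hP1 σ).continuous.mul (hwp _)).integrable_of_hasCompactSupport
      (hwc _).mul_left).const_mul _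

theorem continuous_det_jacobian {F : 𝔼 → 𝔼} (hF : ContDiff ℝ 1 F) :
    Continuous fun x => (jacobian F x).det := by
  refine Continuous.matrix_det (continuous_matrix fun k j => ?_)
  exact (contDiff_partials (m := 0) (hF.component k) (by norm_num) j).continuous

theorem jacobian_congr {F G : 𝔼 → 𝔼} {x : 𝔼} (h : F =ᶠ[𝓝 x] G) : jacobian F x = jacobian G x := by
  ext k j
  have : (fun y => F y k) =ᶠ[𝓝 x] fun y => G y k := h.mono fun y hy => by simp only [hy]
  simp only [jacobian, partials, Matrix.of_apply, this.fderiv_eq]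

theorem mul_det_jacobian_sub_eq_zero_of_notMem {F G : 𝔼 → 𝔼} {K : Set 𝔼} (hK : IsCompact K)
    (h : ∀ x ∉ K, F x = G x) (φ : 𝔼 → ℝ) : ∀ x ∉ K,
      φ (F x) * (jacobian F x).det - φ (G x) * (jacobian G x).det = 0 := by
  intro x hx
  have : F =ᶠ[𝓝 x] G := by
    filter_upwards [hK.isClosed.isOpen_compl.mem_nhds hx] with y hy using h y hy
  rw [h x hx, jacobian_congr this, sub_self]

theorem integrable_jacobian_sub {F G : 𝔼 → 𝔼} (hF : ContDiff ℝ 1 F) (hG : ContDiff ℝ 1 G)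
    {K : Set 𝔼} (hK : IsCompact K) (h : ∀ x ∉ K, F x = G x) {φ : 𝔼 → ℝ} (hφ : Continuous φ) :
    Integrable fun x => φ (F x) * (jacobian F x).det - φ (G x) * (jacobian G x).det := by
  refine Continuous.integrable_of_hasCompactSupport ?_
    (HasCompactSupport.intro hK (mul_det_jacobian_sub_eq_zero_of_notMem hK h φ))
  exact ((hφ.comp hF.continuous).mul (continuous_det_jacobian hF)).sub
    ((hφ.comp hG.continuous).mul (continuous_det_jacobian hG))

/-- By the chain rule the gradient is a linear combination of the rows of the Jacobian matrix; in
the determinant only the coefficient of row `i` survives. -/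
theorem det_updateRow_partials_prod {F : 𝔼 → 𝔼} (hF : Differentiable ℝ F) {g : Fin N → ℝ → ℝ}
    (hg : ∀ k, Differentiable ℝ (g k)) (i : Fin N) (x : 𝔼) :
    ((jacobian F x).updateRow i (partials (fun y => ∏ k, g k (F y k)) x)).det
      = (∏ k ∈ Finset.univ.erase i, g k (F x k)) * deriv (g i) (F x i) * (jacobian F x).det := by
  have hcomp : ∀ k, HasFDerivAt (fun y => g k (F y k))
      (deriv (g k) (F x k) • fderiv ℝ (fun y => F y k) x) x := fun k =>
    (hg k (F x k)).hasDerivAt.comp_hasFDerivAt x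
      (hasFDerivAt_component (hF x).hasFDerivAt k).differentiableAt.hasFDerivAt
  have hp : partials (fun y => ∏ k, g k (F y k)) x = ∑ k,
      ((∏ l ∈ Finset.univ.erase k, g l (F x l)) * deriv (g k) (F x k)) • jacobian F x k := by
    ext j
    rw [partials_prod _ (fun k _ => (hcomp k).differentiableAt), Finset.sum_apply]
    refine Finset.sum_congr rfl fun k _ => ?_
    simp [partials, (hcomp k).fderiv, jacobian, mul_assoc]
  rw [hp, Matrix.det_updateRow_sum, smul_eq_mul]

/-- Replacing the factor `ψ` in coordinate `i` by its antiderivative turns each integrand into a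
Jacobian determinant whose row `i` is a gradient. The other rows of `F` and `G` coincide, so the
difference has as row `i` the gradient of a compactly supported function. -/
theorem integral_jacobian_sub_of_coordinate {F G : 𝔼 → 𝔼} (hF : ContDiff ℝ 2 F)
    (hG : ContDiff ℝ 2 G) {K : Set 𝔼} (hK : IsCompact K) (h : ∀ x ∉ K, F x = G x) (i : Fin N)
    (hi : ∀ x, ∀ k ≠ i, F x k = G x k) {ψ : ℝ → ℝ} (hψ : ContDiff ℝ 1 ψ) :
    ∫ x, ((∏ k, ψ (F x k)) * (jacobian F x).det - (∏ k, ψ (G x k)) * (jacobian G x).det) = 0 := by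
  set Ψ : ℝ → ℝ := fun t => ∫ s in (0 : ℝ)..t, ψ s with hΨ
  have hder : ∀ t, HasDerivAt Ψ (ψ t) t := fun t =>
    intervalIntegral.integral_hasDerivAt_right (hψ.continuous.intervalIntegrable _ _)
      (hψ.continuous.stronglyMeasurableAtFilter _ _) hψ.continuous.continuousAt
  have hderiv : deriv Ψ = ψ := funext fun t => (hder t).deriv
  have hΨ1 : ContDiff ℝ 1 Ψ := by
    rw [contDiff_one_iff_deriv, hderiv]
    exact ⟨fun t => (hder t).differentiableAt, hψ.continuous⟩
  set g : Fin N → ℝ → ℝ := Function.update (fun _ => ψ) i Ψ with hg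
  have hg1 : ∀ k, ContDiff ℝ 1 (g k) := by
    intro k
    rcases eq_or_ne k i with rfl | hk
    · simpa [hg] using hΨ1
    · simpa [hg, hk] using hψ
  have hgi : g i = Ψ := by simp [hg]
  have hgk : ∀ k ≠ i, g k = ψ := fun k hk => by simp [hg, hk]
  set u : (𝔼 → 𝔼) → 𝔼 → ℝ := fun A y => ∏ k, g k (A y k) with hu
  have hu1 : ∀ A : 𝔼 → 𝔼, ContDiff ℝ 2 A → ContDiff ℝ 1 (u A) := fun A hA =>
    contDiff_prod fun k _ => (hg1 k).comp ((hA.component k).of_le (by norm_num))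
  have hdet : ∀ A : 𝔼 → 𝔼, ContDiff ℝ 2 A → ∀ x,
      ((jacobian A x).updateRow i (partials (u A) x)).det
        = (∏ k, ψ (A x k)) * (jacobian A x).det := by
    intro A hA x
    rw [det_updateRow_partials_prod (hA.differentiable (by norm_num))
      (fun k => (hg1 k).differentiable (by norm_num)), hgi, hderiv,
      ← Finset.prod_erase_mul _ _ (Finset.mem_univ i)]
    congr 2
    exact Finset.prod_congr rfl fun k hk => by rw [hgk k (Finset.ne_of_mem_erase hk)]
  have hrow : ∀ x r, (jacobian F x).updateRow i r = (jacobian G x).updateRow i r := by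
    intro x r
    ext k j
    rcases eq_or_ne k i with rfl | hk
    · simp
    · have : (fun y => F y k) = fun y => G y k := funext fun y => hi y k hk
      simp [Matrix.updateRow_ne hk, jacobian, this]
  have hw1 : ContDiff ℝ 1 fun x => u F x - u G x := (hu1 F hF).sub (hu1 G hG)
  have hwc : HasCompactSupport fun x => u F x - u G x :=
    HasCompactSupport.intro hK fun x hx => by simp [hu, h x hx]
  rw [← integral_det_updateRow_partials hF hw1 hwc i]
  refine integral_congr_ae (Eventually.of_forall fun x => ?_)
  have hsub : partials (fun x => u F x - u G x) x
      = partials (u F) x + (-1 : ℝ) • partials (u G) x := by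
    ext j
    unfold partials
    rw [fderiv_fun_sub ((hu1 F hF).differentiable (by norm_num) x)
      ((hu1 G hG).differentiable (by norm_num) x)]
    simp [sub_eq_add_neg]
  dsimp only
  rw [hsub, Matrix.det_updateRow_add, Matrix.det_updateRow_smul, hdet F hF,
    hrow x (partials (u G) x), hdet G hG]
  ring

/-- The integral `∫ φ(F) det DF` does not change when `F` is changed on a compact set, for `φ` a
product of functions of one coordinate. -/
theorem integral_jacobian_sub_eq_zero {F G : 𝔼 → 𝔼} (hF : ContDiff ℝ 2 F)
    (hG : ContDiff ℝ 2 G) {K : Set 𝔼} (hK : IsCompact K) (h : ∀ x ∉ K, F x = G x)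
    {ψ : ℝ → ℝ} (hψ : ContDiff ℝ 1 ψ) :
    ∫ x, ((∏ k, ψ (F x k)) * (jacobian F x).det - (∏ k, ψ (G x k)) * (jacobian G x).det) = 0 := by
  -- These maps lead from `G` to `F` by exchanging one coordinate at a time.
  set H : Finset (Fin N) → 𝔼 → 𝔼 := fun s x =>
    WithLp.toLp 2 fun k => if k ∈ s then F x k else G x k with hH
  have hH2 : ∀ s, ContDiff ℝ 2 (H s) := by
    intro s
    rw [contDiff_euclidean]
    intro k
    by_cases hk : k ∈ s
    · simpa [hH, hk] using hF.component k
    · simpa [hH, hk] using hG.component k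
  have hHK : ∀ s t, ∀ x ∉ K, H s x = H t x := by
    intro s t x hx
    ext k
    simp [hH, h x hx]
  have hφ : Continuous fun y : 𝔼 => ∏ k, ψ (y k) :=
    continuous_finsetProd _ fun k _ => hψ.continuous.comp (EuclideanSpace.proj k).continuous
  have key : ∀ s, ∫ x, ((∏ k, ψ (H s x k)) * (jacobian (H s) x).det
      - (∏ k, ψ (H ∅ x k)) * (jacobian (H ∅) x).det) = 0 := by
    intro s
    induction s using Finset.induction_on with
    | empty => simp
    | insert i s hi ih =>
      have hstep := integral_jacobian_sub_of_coordinate (hH2 (insert i s)) (hH2 s) hK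
        (hHK _ _) i (fun x k hk => by simp [hH, hk]) hψ
      have hle : ∀ t, ContDiff ℝ 1 (H t) := fun t => (hH2 t).of_le (by norm_num)
      have := integral_add (integrable_jacobian_sub (hle (insert i s)) (hle s) hK (hHK _ _) hφ)
        (integrable_jacobian_sub (hle s) (hle ∅) hK (hHK _ _) hφ)
      rw [hstep, ih, add_zero] at this
      rw [← this]
      congr 1
      ext x
      ring
  have h1 : H Finset.univ = F := by ext x k; simp [hH]
  have h0 : H ∅ = G := by ext x k; simp [hH]
  have := key Finset.univ
  rwa [h1, h0] at this

end Jacobian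

/-! ### Counting zeros with signs by an integral -/

section SignedCount

variable {N : ℕ}

local notation "𝔼" => EuclideanSpace ℝ (Fin N)

/-- Near a nondegenerate zero `z`, a `C¹` map is a diffeomorphism onto a neighbourhood of the
origin, and `∫ φ(A) det DA` over such a neighbourhood is `± ∫ φ`. -/
theorem exists_nhds_integral_jacobian {A : 𝔼 → 𝔼} (hA : ContDiff ℝ 1 A) {z : 𝔼} (hz : A z = 0)
    (hd : (jacobian A z).det ≠ 0) {V : Set 𝔼} (hV : V ∈ 𝓝 z) :
    ∃ W ⊆ V, IsOpen W ∧ z ∈ W ∧ ∃ s : ℤ, (s = 1 ∨ s = -1) ∧ ∃ ε > 0, ∀ φ : 𝔼 → ℝ,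
      (∀ y, ε ≤ ‖y‖ → φ y = 0) →
        ∫ x in W, φ (A x) * (jacobian A x).det = s * ∫ y, φ y := by
  obtain ⟨s, hs, hsd⟩ : ∃ s : ℤ, (s = 1 ∨ s = -1) ∧ 0 < (s : ℝ) * (jacobian A z).det := by
    rcases hd.lt_or_gt with h | h
    · exact ⟨-1, Or.inr rfl, by push_cast; linarith⟩
    · exact ⟨1, Or.inl rfl, by simpa using h⟩
  have hdz : (fderiv ℝ A z).det ≠ 0 := by
    rwa [det_fderiv_eq_det_jacobian (hA.differentiable (by norm_num) z)]
  have hstrict : HasStrictFDerivAt A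
      (((fderiv ℝ A z).toContinuousLinearEquivOfDetNeZero hdz : 𝔼 ≃L[ℝ] 𝔼) : 𝔼 →L[ℝ] 𝔼) z := by
    rw [ContinuousLinearMap.coe_toContinuousLinearEquivOfDetNeZero]
    exact hA.contDiffAt.hasStrictFDerivAt (by norm_num)
  set e := hstrict.toOpenPartialHomeomorph A with he
  -- On `W` the determinant keeps its sign `s`, so the absolute value in the change of variables
  -- formula equals `s` times the determinant.
  set W : Set 𝔼 := e.source ∩ (interior V ∩ {x | 0 < (s : ℝ) * (jacobian A x).det}) with hW
  have hWo : IsOpen W := e.open_source.inter (isOpen_interior.inter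
    (isOpen_lt continuous_const (continuous_const.mul (continuous_det_jacobian hA))))
  have hzW : z ∈ W :=
    ⟨hstrict.mem_toOpenPartialHomeomorph_source, mem_interior_iff_mem_nhds.2 hV, hsd⟩
  have hinj : InjOn A W := by
    have : InjOn e W := e.injOn.mono inter_subset_left
    rwa [he, HasStrictFDerivAt.toOpenPartialHomeomorph_coe] at this
  have himg : A '' W ∈ 𝓝 (0 : 𝔼) := by
    have : IsOpen (e '' W) := e.isOpen_image_of_subset_source hWo inter_subset_left
    rw [he, HasStrictFDerivAt.toOpenPartialHomeomorph_coe] at this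
    exact this.mem_nhds ⟨z, hzW, hz⟩
  obtain ⟨ε, hε, hball⟩ := Metric.mem_nhds_iff.1 himg
  refine ⟨W, fun x hx => interior_subset hx.2.1, hWo, hzW, s, hs, ε, hε, fun φ hφ => ?_⟩
  have hcv := integral_image_eq_integral_abs_det_fderiv_smul (volume : Measure 𝔼)
    hWo.measurableSet
    (fun x _ => (hA.differentiable (by norm_num) x).hasFDerivAt.hasFDerivWithinAt) hinj φ
  have hall : ∫ y in A '' W, φ y = ∫ y, φ y :=
    setIntegral_eq_integral_of_forall_compl_eq_zero fun y hy => hφ y (by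
      by_contra hlt
      exact hy (hball (by simpa using not_le.1 hlt)))
  rw [← hall, hcv, ← integral_const_mul]
  refine setIntegral_congr_fun hWo.measurableSet fun x hx => ?_
  have hpos : 0 < (s : ℝ) * (jacobian A x).det := hx.2.2
  rw [det_fderiv_eq_det_jacobian (hA.differentiable (by norm_num) x), smul_eq_mul]
  rcases hs with rfl | rfl
  · rw [abs_of_pos (by simpa using hpos)]
    push_cast
    ring
  · rw [abs_of_neg (by push_cast at hpos; linarith)]
    push_cast
    ring

/-- The integral `∫ φ(A) det DA` counts the zeros of `A` with signs, if they are nondegenerate. -/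
theorem setIntegral_jacobian_eq_sum {A : 𝔼 → 𝔼} (hA : ContDiff ℝ 1 A) {L : Set 𝔼}
    (hL : IsCompact L) {Z : Finset 𝔼} (hZ : ∀ x ∈ L, A x = 0 → x ∈ Z)
    (hZL : ∀ z ∈ Z, z ∈ interior L) (hZ0 : ∀ z ∈ Z, A z = 0)
    (hZd : ∀ z ∈ Z, (jacobian A z).det ≠ 0) :
    ∃ s : 𝔼 → ℤ, (∀ z ∈ Z, s z = 1 ∨ s z = -1) ∧ ∃ ε > 0, ∀ φ : 𝔼 → ℝ, Continuous φ →
      (∀ y, ε ≤ ‖y‖ → φ y = 0) →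
        ∫ x in L, φ (A x) * (jacobian A x).det = (∑ z ∈ Z, s z : ℤ) * ∫ y, φ y := by
  obtain ⟨U, hU, hUd⟩ := Z.finite_toSet.t2_separation
  have hloc : ∀ z : 𝔼, ∃ W : Set 𝔼, ∃ s : ℤ, ∃ ε : ℝ, z ∈ Z → W ⊆ U z ∩ interior L ∧ IsOpen W ∧
      z ∈ W ∧ (s = 1 ∨ s = -1) ∧ 0 < ε ∧ ∀ φ : 𝔼 → ℝ, (∀ y, ε ≤ ‖y‖ → φ y = 0) →
        ∫ x in W, φ (A x) * (jacobian A x).det = s * ∫ y, φ y := by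
    intro z
    by_cases hz : z ∈ Z
    · obtain ⟨W, hWV, hWo, hzW, s, hs, ε, hε, h⟩ := exists_nhds_integral_jacobian hA (hZ0 z hz)
        (hZd z hz) (((hU z).2.inter isOpen_interior).mem_nhds ⟨(hU z).1, hZL z hz⟩)
      exact ⟨W, s, ε, fun _ => ⟨hWV, hWo, hzW, hs, hε, h⟩⟩
    · exact ⟨∅, 0, 0, fun h => absurd h hz⟩
  choose W s ε hW using hloc
  have hWo : IsOpen (⋃ z ∈ Z, W z) := isOpen_biUnion fun z hz => (hW z hz).2.1
  -- Away from the chosen neighbourhoods of the zeros `‖A‖` is bounded below, so `φ ∘ A` vanishes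
  -- there once `φ` is supported close enough to `0`.
  obtain ⟨δ, hδ, hδA⟩ : ∃ δ > 0, ∀ x ∈ L \ ⋃ z ∈ Z, W z, δ ≤ ‖A x‖ := by
    refine (hL.diff hWo).exists_forall_le' hA.continuous.norm.continuousOn fun x hx => ?_
    refine norm_pos_iff.2 fun h0 => hx.2 ?_
    have hxZ := hZ x hx.1 h0
    exact mem_biUnion hxZ (hW x hxZ).2.2.1
  obtain ⟨η, ⟨hηδ, hηε⟩, hη⟩ : ∃ η : ℝ, (η ≤ δ ∧ ∀ z ∈ Z, η ≤ ε z) ∧ 0 < η := by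
    have h1 : ∀ᶠ η in 𝓝[>] (0 : ℝ), η ≤ δ := ((eventually_lt_nhds hδ).mono
      fun _ => le_of_lt).filter_mono nhdsWithin_le_nhds
    have h2 : ∀ᶠ η in 𝓝[>] (0 : ℝ), ∀ z ∈ Z, η ≤ ε z := (Finset.eventually_all Z).2 fun z hz =>
      ((eventually_lt_nhds (hW z hz).2.2.2.2.1).mono fun _ => le_of_lt).filter_mono
        nhdsWithin_le_nhds
    exact ((h1.and h2).and self_mem_nhdsWithin).exists
  refine ⟨s, fun z hz => (hW z hz).2.2.2.1, η, hη, fun φ hφ hφη => ?_⟩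
  have hsub : (⋃ z ∈ Z, W z) ⊆ L := iUnion₂_subset fun z hz =>
    ((hW z hz).1.trans inter_subset_right).trans interior_subset
  have hint : IntegrableOn (fun x => φ (A x) * (jacobian A x).det) L :=
    ((hφ.comp hA.continuous).mul (continuous_det_jacobian hA)).continuousOn.integrableOn_compact hL
  rw [setIntegral_eq_of_subset_of_forall_sdiff_eq_zero hL.measurableSet hsub fun x hx => by
      rw [hφη _ (hηδ.trans (hδA x hx)), zero_mul],
    integral_biUnion_finset Z (fun z hz => (hW z hz).2.1.measurableSet)
      (fun z hz z' hz' hne => (hUd hz hz' hne).mono ((hW z hz).1.trans inter_subset_left)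
        ((hW z' hz').1.trans inter_subset_left))
      (fun z hz => hint.mono_set ((subset_biUnion_of_mem (u := W) hz).trans hsub))]
  push_cast
  rw [Finset.sum_mul]
  exact Finset.sum_congr rfl fun z hz =>
    (hW z hz).2.2.2.2.2 φ fun y hy => hφη y ((hηε z hz).trans hy)

end SignedCount

theorem IsCompact.finite_of_eventually_notMem {X : Type*} [TopologicalSpace X] {S : Set X}
    (hS : IsCompact S) (h : ∀ x ∈ S, ∀ᶠ y in 𝓝[≠] x, y ∉ S) : S.Finite := by
  refine hS.finite (isDiscrete_iff_nhdsNE.2 fun x hx => ?_)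
  exact Filter.inf_principal_eq_bot.2 (h x hx)

/-! ### Parity of the number of zeros under compactly supported changes -/

section Parity

variable {N : ℕ}

local notation "𝔼" => EuclideanSpace ℝ (Fin N)

theorem eventually_ne_zero_of_det_ne_zero {A : 𝔼 → 𝔼} {z : 𝔼} (hA : DifferentiableAt ℝ A z)
    (hd : (fderiv ℝ A z).det ≠ 0) : ∀ᶠ y in 𝓝[≠] z, A y ≠ 0 := by
  refine hA.hasFDerivAt.eventually_ne ?_
  have := ((fderiv ℝ A z).toContinuousLinearEquivOfDetNeZero hd).antilipschitz
  exact ⟨_, this⟩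

theorem finite_zeros_of_isCompact {A : 𝔼 → 𝔼} {L : Set 𝔼} (hA : Differentiable ℝ A)
    (hL : IsCompact L) (hd : ∀ z ∈ L, A z = 0 → (fderiv ℝ A z).det ≠ 0) :
    {z ∈ L | A z = 0}.Finite := by
  refine IsCompact.finite_of_eventually_notMem
    (hL.inter_right (isClosed_eq hA.continuous continuous_const)) fun x hx => ?_
  filter_upwards [eventually_ne_zero_of_det_ne_zero (hA x) (hd x hx.1 hx.2)] with y hy hyS
  exact hy hyS.2

/-- The product form is what the invariance of the integral requires. Coordinates below `ε / (N +
1)` force the norm below `ε`, also for `N = 0`. -/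
theorem exists_bump_prod {ε : ℝ} (hε : 0 < ε) : ∃ ψ : ℝ → ℝ, ContDiff ℝ 1 ψ ∧
    (∀ y : 𝔼, ε ≤ ‖y‖ → ∏ k, ψ (y k) = 0) ∧ 0 < ∫ y : 𝔼, ∏ k, ψ (y k) := by
  have hr : 0 < ε / (N + 1) := by positivity
  let ψ : ContDiffBump (0 : ℝ) := ⟨ε / (N + 1) / 2, ε / (N + 1), by positivity, by linarith⟩
  have hzero : ∀ y : 𝔼, ε ≤ ‖y‖ → ∏ k, ψ (y k) = 0 := by
    intro y hy
    by_contra hne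
    have hk : ∀ k, |y k| < ε / (N + 1) := by
      intro k
      have h1 : ψ (y k) ≠ 0 := fun h0 => hne (Finset.prod_eq_zero (Finset.mem_univ k) h0)
      by_contra hlt
      exact h1 (ψ.zero_of_le_dist (by simpa [Real.dist_eq, ψ] using not_lt.1 hlt))
    have h2 : ‖y‖ ^ 2 ≤ N * (ε / (N + 1)) ^ 2 := by
      rw [EuclideanSpace.norm_sq_eq]
      calc ∑ k, ‖y k‖ ^ 2 ≤ ∑ _k : Fin N, (ε / (N + 1)) ^ 2 := by
            gcongr with k
            exact (hk k).le
        _ = N * (ε / (N + 1)) ^ 2 := by simp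
    have h3 : ε ^ 2 ≤ ‖y‖ ^ 2 := pow_le_pow_left₀ hε.le hy 2
    have h4 : ε = (ε / (N + 1)) * (N + 1) := by field_simp
    have hN : (0 : ℝ) ≤ N := Nat.cast_nonneg N
    have h5 : ε ^ 2 = (ε / (N + 1)) ^ 2 * (N + 1) ^ 2 := by rw [← mul_pow, ← h4]
    have h6 : 0 < (ε / (N + 1)) ^ 2 := by positivity
    nlinarith [mul_nonneg h6.le hN, mul_nonneg h6.le (mul_nonneg hN hN)]
  have hcont : Continuous fun y : 𝔼 => ∏ k, ψ (y k) :=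
    continuous_finsetProd _ fun k _ => ψ.continuous.comp (EuclideanSpace.proj k).continuous
  refine ⟨ψ, ψ.contDiff, hzero, ?_⟩
  refine hcont.integral_pos_of_hasCompactSupport_nonneg_nonzero (x := 0) ?_
    (fun y => Finset.prod_nonneg fun k _ => ψ.nonneg) ?_
  · refine HasCompactSupport.intro (isCompact_closedBall (0 : 𝔼) ε) fun y hy => hzero y ?_
    simpa using (not_le.1 (by simpa using hy)).le
  · have : ψ 0 = 1 := ψ.one_of_mem_closedBall (by simpa using ψ.rIn_pos.le)
    simp [this]

theorem card_modEq_of_sum_eq {ι : Type*} {S T : Finset ι} {s t : ι → ℤ}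
    (hs : ∀ z ∈ S, s z = 1 ∨ s z = -1) (ht : ∀ z ∈ T, t z = 1 ∨ t z = -1)
    (h : ∑ z ∈ S, s z = ∑ z ∈ T, t z) : S.card ≡ T.card [MOD 2] := by
  have key : ∀ (S : Finset ι) (s : ι → ℤ), (∀ z ∈ S, s z = 1 ∨ s z = -1) →
      (∑ z ∈ S, s z) ≡ S.card [ZMOD 2] := by
    intro S s hs
    rw [Finset.card_eq_sum_ones, Nat.cast_sum]
    refine Int.ModEq.sum fun z hz => ?_
    rcases hs z hz with h | h <;> rw [h] <;> decide
  have := (key S s hs).symm.trans (h ▸ key T t ht)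
  exact_mod_cast this

/-- Two maps of Euclidean space that agree outside a compact set have the same number of zeros
modulo two near it, if their zeros there are nondegenerate. -/
theorem ncard_zeros_modEq_of_eq_off_compact {F G : 𝔼 → 𝔼} (hF : ContDiff ℝ 2 F)
    (hG : ContDiff ℝ 2 G) {K L : Set 𝔼} (hK : IsCompact K) (hL : IsCompact L)
    (hKL : K ⊆ interior L) (h : ∀ x ∉ K, F x = G x)
    (hFK : ∀ z ∈ L, F z = 0 → z ∈ K) (hGK : ∀ z ∈ L, G z = 0 → z ∈ K)
    (hFd : ∀ z ∈ L, F z = 0 → (fderiv ℝ F z).det ≠ 0)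
    (hGd : ∀ z ∈ L, G z = 0 → (fderiv ℝ G z).det ≠ 0) :
    {z ∈ L | F z = 0}.ncard ≡ {z ∈ L | G z = 0}.ncard [MOD 2] := by
  have key : ∀ A : 𝔼 → 𝔼, ContDiff ℝ 2 A → (∀ z ∈ L, A z = 0 → z ∈ K) →
      (∀ z ∈ L, A z = 0 → (fderiv ℝ A z).det ≠ 0) →
      ∃ Z : Finset 𝔼, {z ∈ L | A z = 0}.ncard = Z.card ∧
      ∃ s : 𝔼 → ℤ, (∀ z ∈ Z, s z = 1 ∨ s z = -1) ∧ ∃ ε > 0, ∀ φ : 𝔼 → ℝ, Continuous φ →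
      (∀ y, ε ≤ ‖y‖ → φ y = 0) →
        ∫ x in L, φ (A x) * (jacobian A x).det = (∑ z ∈ Z, s z : ℤ) * ∫ y, φ y := by
    intro A hA hAK hAd
    have hd := hA.differentiable (by norm_num)
    have hfin := finite_zeros_of_isCompact hd hL hAd
    have hmem : ∀ z ∈ hfin.toFinset, z ∈ L ∧ A z = 0 := fun z hz => by simpa using hz
    refine ⟨hfin.toFinset, Set.ncard_eq_toFinset_card _ hfin, ?_⟩
    refine setIntegral_jacobian_eq_sum (hA.of_le (by norm_num)) hL
      (fun x hx h0 => by simpa using ⟨hx, h0⟩)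
      (fun z hz => hKL (hAK z (hmem z hz).1 (hmem z hz).2)) (fun z hz => (hmem z hz).2)
      (fun z hz => ?_)
    rw [← det_fderiv_eq_det_jacobian (hd z)]
    exact hAd z (hmem z hz).1 (hmem z hz).2
  obtain ⟨S, hS, s, hs, ε, hε, hsum⟩ := key F hF hFK hFd
  obtain ⟨T, hT, t, ht, δ, hδ, htum⟩ := key G hG hGK hGd
  obtain ⟨ψ, hψ, hψ0, hpos⟩ := exists_bump_prod (N := N) (lt_min hε hδ)
  have hφ : Continuous fun y : 𝔼 => ∏ k, ψ (y k) :=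
    continuous_finsetProd _ fun k _ => hψ.continuous.comp (EuclideanSpace.proj k).continuous
  have h1 := hsum _ hφ fun y hy => hψ0 y ((min_le_left _ _).trans hy)
  have h2 := htum _ hφ fun y hy => hψ0 y ((min_le_right _ _).trans hy)
  have hF1 : ContDiff ℝ 1 F := hF.of_le (by norm_num)
  have hG1 : ContDiff ℝ 1 G := hG.of_le (by norm_num)
  have hzero := integral_jacobian_sub_eq_zero hF hG hK h hψ
  have hint : ∀ A : 𝔼 → 𝔼, ContDiff ℝ 1 A →
      IntegrableOn (fun x => (∏ k, ψ (A x k)) * (jacobian A x).det) L := fun A hA =>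
    ((hφ.comp hA.continuous).mul (continuous_det_jacobian hA)).continuousOn.integrableOn_compact hL
  -- Only the difference is known to be integrable on the whole space; it vanishes off `K`, and over
  -- the compact `L` the integral may be split.
  rw [← setIntegral_eq_integral_of_forall_compl_eq_zero (s := L) fun x hx =>
      mul_det_jacobian_sub_eq_zero_of_notMem hK h (fun y => ∏ k, ψ (y k)) x
        fun hxK => hx (interior_subset (hKL hxK)),
    integral_sub (hint F hF1) (hint G hG1)] at hzero
  rw [h1, h2, ← sub_mul] at hzero
  have heq := (mul_eq_zero.1 hzero).resolve_right hpos.ne'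
  rw [hS, hT]
  exact card_modEq_of_sum_eq hs ht (by exact_mod_cast sub_eq_zero.1 heq)

theorem exists_contDiff_cutoff {K U : Set 𝔼} (hK : IsCompact K) (hU : IsOpen U) (h : K ⊆ U) :
    ∃ η : 𝔼 → ℝ, ContDiff ℝ 2 η ∧ (∀ᶠ x in 𝓝ˢ K, η x = 1) ∧ tsupport η ⊆ U := by
  obtain ⟨L, hL, hKL, hLU⟩ := exists_compact_between hK hU h
  obtain ⟨η, h1, h0, -⟩ := exists_contMDiffMap_one_nhds_of_subset_interior (n := 2) 𝓘(ℝ, 𝔼)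
    hK.isClosed hKL
  refine ⟨η, η.contMDiff.contDiff, h1, ?_⟩
  refine (closure_minimal (fun x hx => ?_) hL.isClosed).trans hLU
  by_contra hxL
  exact hx (h0 x hxL)

/-- Two maps on an open set `V` that agree outside a compact set have the same number of zeros
modulo two in it, if their zeros are nondegenerate. -/
theorem ncard_zeros_modEq_of_contDiffOn {F G : 𝔼 → 𝔼} {K V : Set 𝔼} (hV : IsOpen V)
    (hF : ContDiffOn ℝ 2 F V) (hG : ContDiffOn ℝ 2 G V) (hK : IsCompact K) (hKV : K ⊆ V)
    (h : ∀ x ∈ V \ K, F x = G x)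
    (hFd : ∀ z ∈ V, F z = 0 → (fderiv ℝ F z).det ≠ 0)
    (hGd : ∀ z ∈ V, G z = 0 → (fderiv ℝ G z).det ≠ 0) :
    {z ∈ K | F z = 0}.ncard ≡ {z ∈ K | G z = 0}.ncard [MOD 2] := by
  -- Removing the zeros of `F` outside `K` leaves an open set, since zeros are isolated. A cutoff
  -- supported in `U` then extends both maps to the whole space, unchanged near a compact `L` whose
  -- only zeros lie in `K`.
  set U : Set 𝔼 := {x ∈ V | F x = 0 → x ∈ K} with hU
  have hUo : IsOpen U := by
    rw [isOpen_iff_mem_nhds]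
    rintro x ⟨hxV, hxK⟩
    have hVx := hV.mem_nhds hxV
    by_cases h0 : F x = 0
    · have hev := eventually_ne_zero_of_det_ne_zero
        ((hF.contDiffAt hVx).differentiableAt (by norm_num)) (hFd x hxV h0)
      rw [eventually_nhdsWithin_iff] at hev
      filter_upwards [hVx, hev] with y hyV hy
      refine ⟨hyV, fun hy0 => ?_⟩
      by_cases hyx : y = x
      · exact hyx ▸ hxK h0
      · exact absurd hy0 (hy hyx)
    · filter_upwards [hVx, ((hF.contDiffAt hVx).continuousAt).eventually_ne h0] with y hyV hy
      exact ⟨hyV, fun hy0 => absurd hy0 hy⟩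
  have hKU : K ⊆ U := fun x hx => ⟨hKV hx, fun _ => hx⟩
  obtain ⟨L, hL, hKL, hLU⟩ := exists_compact_between hK hUo hKU
  obtain ⟨η, hη, hη1, hηU⟩ := exists_contDiff_cutoff hL hUo hLU
  have hη1L : ∀ x ∈ L, ∀ᶠ y in 𝓝 x, η y = 1 := fun x hx =>
    (Filter.eventually_iff.1 hη1 |> mem_nhdsSet_iff_forall.1) x hx
  have hsmooth : ∀ A : 𝔼 → 𝔼, ContDiffOn ℝ 2 A V → ContDiff ℝ 2 fun x => η x • A x := by
    intro A hA
    rw [contDiff_iff_contDiffAt]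
    intro x
    by_cases hx : x ∈ tsupport η
    · exact hη.contDiffAt.smul (hA.contDiffAt (hV.mem_nhds (hηU hx).1))
    · refine contDiffAt_const (c := (0 : 𝔼)) |>.congr_of_eventuallyEq ?_
      filter_upwards [(isClosed_tsupport η).isOpen_compl.mem_nhds hx] with y hy
      rw [image_eq_zero_of_notMem_tsupport hy, zero_smul]
  have hloc : ∀ A : 𝔼 → 𝔼, ∀ x ∈ L, (fun x => η x • A x) =ᶠ[𝓝 x] A := fun A x hx =>
    (hη1L x hx).mono fun y hy => by simp only [hy, one_smul]
  have hset : ∀ A : 𝔼 → 𝔼, (∀ z ∈ L, A z = 0 → z ∈ K) →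
      {z ∈ K | A z = 0} = {z ∈ L | η z • A z = 0} := by
    intro A hA
    ext z
    constructor
    · rintro ⟨hz, h0⟩
      exact ⟨interior_subset (hKL hz), by simp [h0]⟩
    · rintro ⟨hz, h0⟩
      have h0' : A z = 0 := (hloc A z hz).eq_of_nhds ▸ h0
      exact ⟨hA z hz h0', h0'⟩
  have hFL : ∀ z ∈ L, F z = 0 → z ∈ K := fun z hz => (hLU hz).2
  have hGL : ∀ z ∈ L, G z = 0 → z ∈ K := fun z hz h0 => by
    by_contra hzK
    exact hzK (hFL z hz ((h z ⟨(hLU hz).1, hzK⟩).trans h0))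
  rw [hset F hFL, hset G hGL]
  refine ncard_zeros_modEq_of_eq_off_compact (hsmooth F hF) (hsmooth G hG) hK hL hKL ?_ ?_ ?_ ?_ ?_
  · intro x hx
    by_cases hxV : x ∈ V
    · rw [h x ⟨hxV, hx⟩]
    · rw [image_eq_zero_of_notMem_tsupport fun hx' => hxV (hηU hx').1, zero_smul, zero_smul]
  · exact fun z hz h0 => hFL z hz ((hloc F z hz).eq_of_nhds ▸ h0)
  · exact fun z hz h0 => hGL z hz ((hloc G z hz).eq_of_nhds ▸ h0)
  · intro z hz h0
    rw [(hloc F z hz).fderiv_eq]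
    exact hFd z (hLU hz).1 ((hloc F z hz).eq_of_nhds ▸ h0)
  · intro z hz h0
    rw [(hloc G z hz).fderiv_eq]
    exact hGd z (hLU hz).1 ((hloc G z hz).eq_of_nhds ▸ h0)

end Parity

theorem det_ne_zero_iff_surjective {V : Type*} [NormedAddCommGroup V] [NormedSpace ℝ V]
    [FiniteDimensional ℝ V] (L : V →L[ℝ] V) : L.det ≠ 0 ↔ Function.Surjective L := by
  rw [ContinuousLinearMap.det, ← isUnit_iff_ne_zero, ← LinearMap.isUnit_iff_isUnit_det,
    LinearMap.isUnit_iff_range_eq_top, LinearMap.range_eq_top]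
  rfl

/-! ### Choosing a generic constant by Sard's theorem -/

section Perturbation

variable {N : ℕ}

local notation "𝔼" => EuclideanSpace ℝ (Fin N)

/-- Interpolating between a map with nondegenerate zeros and a generic constant gives a map with
nondegenerate zeros. -/
theorem exists_interpolation_nondegenerate {A : 𝔼 → 𝔼} {p : 𝔼 → ℝ} {V O : Set 𝔼} (hV : IsOpen V)
    (hA : DifferentiableOn ℝ A V) (hp : DifferentiableOn ℝ p V) (hp0 : ∀ z, 0 ≤ p z)
    (hd : ∀ z ∈ V, A z = 0 → (fderiv ℝ A z).det ≠ 0) (hO : IsOpen O) (hOne : O.Nonempty) :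
    ∃ c ∈ O, ∀ z ∈ V, A z + p z • (c - A z) = 0 →
      (fderiv ℝ (fun y => A y + p y • (c - A y)) z).det ≠ 0 := by
  have hAd : ∀ z ∈ V, DifferentiableAt ℝ A z := fun z hz => hA.differentiableAt (hV.mem_nhds hz)
  have hpd : ∀ z ∈ V, DifferentiableAt ℝ p z := fun z hz => hp.differentiableAt (hV.mem_nhds hz)
  -- Where `p ≠ 0`, the interpolation equals `p • (c - B)`, so its zeros are the solutions of `B z =
  -- c`, nondegenerate if `c` avoids the critical values of `B`, a null set.
  set B : 𝔼 → 𝔼 := fun z => A z - (p z)⁻¹ • A z with hB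
  have hBd : ∀ z ∈ V, p z ≠ 0 → DifferentiableAt ℝ B z := fun z hz hpz =>
    (hAd z hz).sub (((hpd z hz).inv hpz).smul (hAd z hz))
  set S : Set 𝔼 := {z ∈ V | p z ≠ 0 ∧ (fderiv ℝ B z).det = 0} with hS
  have hnull : volume (B '' S) = 0 :=
    addHaar_image_eq_zero_of_det_fderivWithin_eq_zero volume
      (fun z hz => (hBd z hz.1 hz.2.1).hasFDerivAt.hasFDerivWithinAt) fun z hz => hz.2.2
  obtain ⟨c, hcO, hc⟩ : ∃ c ∈ O, c ∉ B '' S := by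
    by_contra! hcon
    exact (hO.measure_pos volume hOne).ne' (measure_mono_null hcon hnull)
  refine ⟨c, hcO, fun z hz h0 => ?_⟩
  by_cases hpz : p z = 0
  -- Here `p` attains its minimum, so the interpolation has the same value and derivative as `A`.
  · have hpd0 : fderiv ℝ p z = 0 :=
      IsLocalMin.fderiv_eq_zero (Eventually.of_forall fun y => by rw [hpz]; exact hp0 y)
    have hder := (hAd z hz).hasFDerivAt.add
      ((hpd z hz).hasFDerivAt.smul ((hAd z hz).hasFDerivAt.const_sub c))
    rw [hpd0, hpz] at hder
    have heq : fderiv ℝ (fun y => A y + p y • (c - A y)) z = fderiv ℝ A z := by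
      refine HasFDerivAt.fderiv (hder.congr_fderiv ?_)
      ext v
      simp
    rw [heq]
    exact hd z hz (by simpa [hpz] using h0)
  · have hBc : B z = c := by
      have h1 : (p z)⁻¹ • (A z + p z • (c - A z)) = 0 := by rw [h0, smul_zero]
      rw [smul_add, inv_smul_smul₀ hpz] at h1
      rw [hB]
      dsimp only
      rw [← sub_eq_zero, ← neg_eq_zero, ← h1]
      abel
    have hdB : (fderiv ℝ B z).det ≠ 0 := fun h => hc ⟨z, ⟨hz, hpz, h⟩, hBc⟩
    have hloc : (fun y => A y + p y • (c - A y)) =ᶠ[𝓝 z] fun y => p y • (c - B y) := by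
      filter_upwards [(hpd z hz).continuousAt.eventually_ne hpz] with y hy
      simp only [hB, smul_sub, smul_inv_smul₀ hy]
      abel
    have hder := (hpd z hz).hasFDerivAt.smul ((hBd z hz hpz).hasFDerivAt.const_sub c)
    have heq : fderiv ℝ (fun y => A y + p y • (c - A y)) z = (-p z) • fderiv ℝ B z := by
      rw [hloc.fderiv_eq]
      refine HasFDerivAt.fderiv (hder.congr_fderiv ?_)
      ext v
      simp [hBc]
    rw [heq, det_ne_zero_iff_surjective]
    intro y
    obtain ⟨v, hv⟩ := (det_ne_zero_iff_surjective _).1 hdB ((-p z)⁻¹ • y)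
    exact ⟨v, by
      rw [smul_apply, hv, smul_inv_smul₀ (neg_ne_zero.2 hpz)]⟩

end Perturbation

/-! ### Regular zeros read in a chart -/

section Chart

variable {N : ℕ} {X : Type*} [TopologicalSpace X] [ChartedSpace (EuclideanSpace ℝ (Fin N)) X]
  [IsManifold (𝓡 N) ∞ X]

local notation "𝔼" => EuclideanSpace ℝ (Fin N)

theorem ContMDiff.contDiffOn_comp_chart_symm {V : Type*} [NormedAddCommGroup V] [NormedSpace ℝ V]
    {F : X → V} (hF : ContMDiff (𝓡 N) 𝓘(ℝ, V) ∞ F) (x : X) :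
    ContDiffOn ℝ ∞ (F ∘ (chartAt 𝔼 x).symm) (chartAt 𝔼 x).target :=
  contMDiffOn_iff_contDiffOn.1 (hF.comp_contMDiffOn contMDiffOn_chart_symm)

theorem surjective_mfderiv_iff_det_ne_zero {F : X → 𝔼}
    (hF : ContMDiff (𝓡 N) 𝓘(ℝ, 𝔼) ∞ F) (x : X) {y : X} (hy : y ∈ (chartAt 𝔼 x).source) :
    Function.Surjective (mfderiv (𝓡 N) 𝓘(ℝ, 𝔼) F y) ↔
      (fderiv ℝ (F ∘ (chartAt 𝔼 x).symm) (chartAt 𝔼 x y)).det ≠ 0 := by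
  have : IsManifold (𝓡 N) 1 X := IsManifold.of_le (n := ∞) (by norm_num)
  have he := mdifferentiable_chart (I := 𝓡 N) x
  have hz : chartAt 𝔼 x y ∈ (chartAt 𝔼 x).target := (chartAt 𝔼 x).map_source hy
  have hbij := he.symm.mfderiv_bijective (x := chartAt 𝔼 x y) hz
  have hcomp := mfderiv_comp (I := 𝓡 N) (I' := 𝓡 N) (I'' := 𝓘(ℝ, 𝔼)) (chartAt 𝔼 x y)
    (hF.mdifferentiable (by norm_num) ((chartAt 𝔼 x).symm (chartAt 𝔼 x y)))
    (he.symm.mdifferentiableAt hz)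
  rw [det_ne_zero_iff_surjective, ← mfderiv_eq_fderiv]
  rw [(chartAt 𝔼 x).left_inv hy] at hcomp
  have hcoe : (mfderiv (𝓡 N) 𝓘(ℝ, 𝔼) (F ∘ (chartAt 𝔼 x).symm) (chartAt 𝔼 x y) : 𝔼 → 𝔼)
      = (mfderiv (𝓡 N) 𝓘(ℝ, 𝔼) F y : 𝔼 → 𝔼) ∘
        (mfderiv (𝓡 N) (𝓡 N) (chartAt 𝔼 x).symm (chartAt 𝔼 x y) : 𝔼 → 𝔼) := by
    rw [hcomp]; rfl
  exact (Function.Surjective.of_comp_iff _ hbij.surjective).symm.trans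
    (iff_of_eq (congrArg Function.Surjective hcoe.symm))

theorem finite_zeros_of_isRegularValue [CompactSpace X] {F : X → 𝔼}
    (hF : ContMDiff (𝓡 N) 𝓘(ℝ, 𝔼) ∞ F) (h0 : IsRegularValue (𝓡 N) F 0) :
    (F ⁻¹' {0}).Finite := by
  refine IsCompact.finite_of_eventually_notMem
    ((isClosed_singleton.preimage hF.continuous).isCompact) fun x hx => ?_
  set e := chartAt 𝔼 x with he
  have hxs : x ∈ e.source := mem_chart_source 𝔼 x
  have hdet := (surjective_mfderiv_iff_det_ne_zero hF x hxs).1 (h0 x hx)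
  have hev := eventually_ne_zero_of_det_ne_zero
    (((hF.contDiffOn_comp_chart_symm x).contDiffAt
      (e.open_target.mem_nhds (e.map_source hxs))).differentiableAt (by norm_num)) hdet
  rw [eventually_nhdsWithin_iff] at hev ⊢
  filter_upwards [(e.continuousAt hxs).eventually hev, e.open_source.mem_nhds hxs] with y hy hys hyx
  have := hy fun h => hyx (e.injOn hys hxs h)
  rw [Function.comp_apply, e.left_inv hys] at this
  exact this

end Chart

/-! ### Free actions of finite groups -/

section Free

variable {G X : Type*} [Group G] [MulAction G X]

theorem smul_ne_of_ncard_orbit [Finite G] {x : X}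
    (h : (MulAction.orbit G x).ncard = Nat.card G) {g : G} (hg : g ≠ 1) : g • x ≠ x := by
  intro hgx
  have hinj : InjOn (fun g : G => g • x) univ := by
    refine injOn_of_ncard_image_eq ?_ finite_univ
    rw [image_univ, ncard_univ]
    exact h
  exact hg (hinj (mem_univ g) (mem_univ 1) (by simpa using hgx))

theorem exists_nhds_smul_notMem [TopologicalSpace X] [T2Space X] [Finite G]
    (hc : ∀ g : G, Continuous fun x : X => g • x) {x : X} (hx : ∀ g : G, g ≠ 1 → g • x ≠ x) :
    ∃ U ∈ 𝓝 x, ∀ g : G, g ≠ 1 → ∀ y ∈ U, g • y ∉ U := by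
  have hloc : ∀ g : G, ∃ U ∈ 𝓝 x, g ≠ 1 → ∀ y ∈ U, g • y ∉ U := by
    intro g
    by_cases hg : g = 1
    · exact ⟨univ, univ_mem, fun h => absurd hg h⟩
    · obtain ⟨u, v, hu, hv, hgu, hxv, huv⟩ := t2_separation (hx g hg)
      refine ⟨v ∩ (fun y => g • y) ⁻¹' u, inter_mem (hv.mem_nhds hxv)
        ((hu.preimage (hc g)).mem_nhds hgu), fun _ y hy hgy => ?_⟩
      exact huv.notMem_of_mem_left hy.2 hgy.1
  choose U hU hUg using hloc
  refine ⟨⋂ g, U g, Filter.iInter_mem.2 hU, fun g hg y hy hgy => ?_⟩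
  exact hUg g hg y (mem_iInter.1 hy g) (mem_iInter.1 hgy g)

/-- The translates of `K` are pairwise disjoint and each meets the invariant set `S` in a copy of `S
∩ K`. -/
theorem ncard_inter_iUnion_smul [Finite G] {S K : Set X} (hS : ∀ g : G, ∀ y ∈ S, g • y ∈ S)
    (hK : ∀ g : G, g ≠ 1 → ∀ y ∈ K, g • y ∉ K) :
    (S ∩ {y | ∃ g : G, g⁻¹ • y ∈ K}).ncard = Nat.card G * (S ∩ K).ncard := by
  have himg : S ∩ {y | ∃ g : G, g⁻¹ • y ∈ K}
      = (fun q : G × X => q.1 • q.2) '' ((univ : Set G) ×ˢ (S ∩ K)) := by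
    ext y
    constructor
    · rintro ⟨hy, g, hg⟩
      exact ⟨(g, g⁻¹ • y), ⟨mem_univ _, hS _ _ hy, hg⟩, smul_inv_smul g y⟩
    · rintro ⟨⟨g, z⟩, ⟨-, hz⟩, rfl⟩
      exact ⟨hS _ _ hz.1, g, by simpa using hz.2⟩
  rw [himg, InjOn.ncard_image, ncard_prod, ncard_univ]
  rintro ⟨g, y⟩ ⟨-, hy⟩ ⟨g', y'⟩ ⟨-, hy'⟩ h
  dsimp only at h hy hy'
  have hyy : (g'⁻¹ * g) • y = y' := by rw [mul_smul, h, inv_smul_smul]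
  have hgg : g'⁻¹ * g = 1 := by
    by_contra hne
    exact hK _ hne y hy.2 (hyy ▸ hy'.2)
  rw [hgg, one_smul] at hyy
  rw [hyy, inv_mul_eq_one.1 hgg]

end Free

/-! ### Equivariant interpolation towards a constant -/

section Interpolation

variable {G X V : Type*} [Group G] [Fintype G] [MulAction G X] [NormedAddCommGroup V]
  [NormedSpace ℝ V] {ρ : G →* (V ≃ₗᵢ[ℝ] V)}

/-- The equivariant map obtained from `F` by interpolating, with weight `ψ`, towards the
constant `c`, and correspondingly on the translates of the support of `ψ`. -/
noncomputable def equivariantInterpolation (ρ : G →* (V ≃ₗᵢ[ℝ] V)) (ψ : X → ℝ) (c : V)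
    (F : X → V) (y : X) : V :=
  F y + ∑ g : G, ψ (g⁻¹ • y) • (ρ g c - F y)

theorem IsEquivariant.equivariantInterpolation {F : X → V} (hF : IsEquivariant ρ F) (ψ : X → ℝ)
    (c : V) : IsEquivariant ρ (equivariantInterpolation ρ ψ c F) := by
  intro g y
  unfold _root_.equivariantInterpolation
  rw [← Equiv.sum_comp (Equiv.mulLeft g)]
  simp [hF g y, mul_smul, map_sum]

theorem equivariantInterpolation_of_forall_eq_zero {ψ : X → ℝ} {c : V} {F : X → V} {y : X}
    (h : ∀ g : G, ψ (g⁻¹ • y) = 0) : equivariantInterpolation ρ ψ c F y = F y := by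
  simp [equivariantInterpolation, h]

theorem equivariantInterpolation_of_mem {ψ : X → ℝ} {c : V} {F : X → V} {U : Set X}
    (hU : ∀ g : G, g ≠ 1 → ∀ y ∈ U, g • y ∉ U) (hψ : ∀ y, ψ y ≠ 0 → y ∈ U) {y : X} (hy : y ∈ U) :
    equivariantInterpolation ρ ψ c F y = F y + ψ y • (c - F y) := by
  unfold equivariantInterpolation
  rw [Finset.sum_eq_single 1 _ (by simp)]
  · simp
  · intro g _ hg
    have : ψ (g⁻¹ • y) = 0 := by
      by_contra hne
      exact hU g⁻¹ (inv_ne_one.2 hg) y hy (hψ _ hne)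
    rw [this, zero_smul]

theorem norm_add_smul_sub_sub_le {a b c : V} {t ε : ℝ} (ht0 : 0 ≤ t) (ht1 : t ≤ 1)
    (ha : ‖a - b‖ ≤ ε) (hc : ‖c - b‖ ≤ ε) : ‖a + t • (c - a) - b‖ ≤ ε := by
  have h := (convex_closedBall b ε) (mem_closedBall_iff_norm.2 ha) (mem_closedBall_iff_norm.2 hc)
    (sub_nonneg.2 ht1) ht0 (by ring)
  rw [mem_closedBall_iff_norm] at h
  have heq : a + t • (c - a) - b = (1 - t) • a + t • c - b := by module
  rwa [heq]

/-- If some translate of `y` lies where `ψ ≠ 0`, the isometries carry the estimate there, where the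
new value is a convex combination of two points of the ball around the value of `h`. -/
theorem norm_equivariantInterpolation_sub_le {ψ : X → ℝ} {c : V} {F h : X → V} {U : Set X} {ε : ℝ}
    (hF : IsEquivariant ρ F) (hh : IsEquivariant ρ h)
    (hU : ∀ g : G, g ≠ 1 → ∀ y ∈ U, g • y ∉ U) (hψ : ∀ y, ψ y ≠ 0 → y ∈ U)
    (hψ01 : ∀ y, ψ y ∈ Icc (0 : ℝ) 1) (hc : ∀ y ∈ U, ‖c - h y‖ ≤ ε) {y : X}
    (hy : ‖F y - h y‖ ≤ ε) : ‖equivariantInterpolation ρ ψ c F y - h y‖ ≤ ε := by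
  by_cases hex : ∀ g : G, ψ (g⁻¹ • y) = 0
  · rwa [equivariantInterpolation_of_forall_eq_zero hex]
  · push Not at hex
    obtain ⟨g, hg⟩ := hex
    have hgU := hψ _ hg
    have hFg := hF.equivariantInterpolation ψ c g⁻¹ y
    rw [← (ρ g⁻¹).norm_map, map_sub, ← hFg, ← hh,
      equivariantInterpolation_of_mem hU hψ hgU]
    refine norm_add_smul_sub_sub_le (hψ01 _).1 (hψ01 _).2 ?_ (hc _ hgU)
    rwa [hF, hh, ← map_sub, (ρ g⁻¹).norm_map]

end Interpolation

/-! ### Equivariant deformation and conclusion -/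

section Main

variable {N : ℕ} {X : Type*} [TopologicalSpace X] [ChartedSpace (EuclideanSpace ℝ (Fin N)) X]
  {G : Type*} [Group G] [MulAction G X]

local notation "𝔼" => EuclideanSpace ℝ (Fin N)

theorem ContMDiff.equivariantInterpolation [Fintype G]
    (hsmooth : ∀ g : G, ContMDiff (𝓡 N) (𝓡 N) ∞ (fun x : X => g • x))
    {ρ : G →* (𝔼 ≃ₗᵢ[ℝ] 𝔼)} {ψ : X → ℝ} (hψ : ContMDiff (𝓡 N) 𝓘(ℝ, ℝ) ∞ ψ) {F : X → 𝔼}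
    (hF : ContMDiff (𝓡 N) 𝓘(ℝ, 𝔼) ∞ F) (c : 𝔼) :
    ContMDiff (𝓡 N) 𝓘(ℝ, 𝔼) ∞ (equivariantInterpolation ρ ψ c F) := by
  refine hF.add (contMDiff_finsetSum fun g _ => ?_)
  exact (hψ.comp (hsmooth g⁻¹)).smul (contMDiff_const.sub hF)

/-- Differentiate `ρ g ∘ F = F ∘ (g • ·)`: the left side has surjective differential at `y`, and the
right side factors through the differential at `g • y`. -/
theorem surjective_mfderiv_smul
    (hsmooth : ∀ g : G, ContMDiff (𝓡 N) (𝓡 N) ∞ (fun x : X => g • x))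
    {ρ : G →* (𝔼 ≃ₗᵢ[ℝ] 𝔼)} {F : X → 𝔼} (hF : ContMDiff (𝓡 N) 𝓘(ℝ, 𝔼) ∞ F)
    (he : IsEquivariant ρ F) (g : G) {y : X}
    (h : Function.Surjective (mfderiv (𝓡 N) 𝓘(ℝ, 𝔼) F y)) :
    Function.Surjective (mfderiv (𝓡 N) 𝓘(ℝ, 𝔼) F (g • y)) := by
  have hd := hF.mdifferentiable (by norm_num)
  let L : 𝔼 →L[ℝ] 𝔼 := (ρ g).toContinuousLinearEquiv
  have hFg : L ∘ F = F ∘ fun x : X => g • x := funext fun x => (he g x).symm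
  have h1 := (L.hasMFDerivAt (x := F y)).comp y (hd y).hasMFDerivAt
  have h2 := (hd (g • y)).hasMFDerivAt.comp y
    ((hsmooth g).mdifferentiable (by norm_num) y).hasMFDerivAt
  rw [hFg] at h1
  have heq := hasMFDerivAt_unique h1 h2
  have hsurj : Function.Surjective (L ∘ (mfderiv (𝓡 N) 𝓘(ℝ, 𝔼) F y : 𝔼 → 𝔼)) :=
    (ρ g).surjective.comp h
  have hcoe : L ∘ (mfderiv (𝓡 N) 𝓘(ℝ, 𝔼) F y : 𝔼 → 𝔼)
      = (mfderiv (𝓡 N) 𝓘(ℝ, 𝔼) F (g • y) : 𝔼 → 𝔼) ∘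
        (mfderiv (𝓡 N) (𝓡 N) (fun x : X => g • x) y : 𝔼 → 𝔼) :=
    congrArg (fun M : 𝔼 →L[ℝ] 𝔼 => (M : 𝔼 → 𝔼)) heq
  rw [hcoe] at hsurj
  exact hsurj.of_comp

/-- An equivariant map can be moved close to a given one near a point and its orbit, keeping its
zeros nondegenerate and their number modulo twice the order of the group. -/
theorem exists_equivariant_modification [T2Space X] [CompactSpace X] [IsManifold (𝓡 N) ∞ X]
    [Finite G] (hsmooth : ∀ g : G, ContMDiff (𝓡 N) (𝓡 N) ∞ (fun x : X => g • x))
    {ρ : G →* (𝔼 ≃ₗᵢ[ℝ] 𝔼)} {h : X → 𝔼} (hh : IsEquivariant ρ h) {x : X} {U : Set X} (hUo : IsOpen U)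
    (hU : ∀ g : G, g ≠ 1 → ∀ y ∈ U, g • y ∉ U) {ψ : SmoothBumpFunction (𝓡 N) x}
    (hψU : tsupport ψ ⊆ U) {ε : ℝ} (hε : 0 < ε) (hUh : ∀ y ∈ U, ‖h x - h y‖ ≤ ε / 2)
    {F : X → 𝔼} (hF : ContMDiff (𝓡 N) 𝓘(ℝ, 𝔼) ∞ F) (hFe : IsEquivariant ρ F)
    (hF0 : IsRegularValue (𝓡 N) F 0) :
    ∃ F' : X → 𝔼, ContMDiff (𝓡 N) 𝓘(ℝ, 𝔼) ∞ F' ∧ IsEquivariant ρ F' ∧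
      IsRegularValue (𝓡 N) F' 0 ∧
      (F ⁻¹' {0}).ncard ≡ (F' ⁻¹' {0}).ncard [MOD Nat.card G * 2] ∧
      (∀ y, ‖F y - h y‖ ≤ ε → ‖F' y - h y‖ ≤ ε) ∧ ∀ y, ψ y = 1 → ‖F' y - h y‖ ≤ ε := by
  have := Fintype.ofFinite G
  set e := chartAt 𝔼 x with he
  set K : Set X := tsupport ψ with hK
  have hKs : K ⊆ e.source := ψ.tsupport_subset_chartAt_source
  have hKc : IsCompact K := (isClosed_tsupport _).isCompact
  have hψs : ContMDiff (𝓡 N) 𝓘(ℝ, ℝ) ∞ ψ := ψ.contMDiff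
  have hψ01 : ∀ y, ψ y ∈ Icc (0 : ℝ) 1 := fun y => ψ.mem_Icc
  have hψK : ∀ y, ψ y ≠ 0 → y ∈ K := fun y hy => subset_tsupport _ hy
  have hψmem : ∀ y, ψ y ≠ 0 → y ∈ U := fun y hy => hψU (hψK y hy)
  have hKfree : ∀ g : G, g ≠ 1 → ∀ y ∈ K, g • y ∉ K := fun g hg y hy hgy =>
    hU g hg y (hψU hy) (hψU hgy)
  set A : 𝔼 → 𝔼 := F ∘ e.symm with hA
  set p : 𝔼 → ℝ := ψ ∘ e.symm with hp
  set V : Set 𝔼 := e.target ∩ e.symm ⁻¹' U with hV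
  have hVo : IsOpen V := e.symm.isOpen_inter_preimage hUo
  have hAs : ContDiffOn ℝ ∞ A V := (hF.contDiffOn_comp_chart_symm x).mono inter_subset_left
  have hps : ContDiffOn ℝ ∞ p V := (hψs.contDiffOn_comp_chart_symm x).mono inter_subset_left
  have hAd : ∀ z ∈ V, A z = 0 → (fderiv ℝ A z).det ≠ 0 := by
    intro z hz h0
    have := (surjective_mfderiv_iff_det_ne_zero hF x (e.map_target hz.1)).1 (hF0 _ h0)
    rwa [← he, e.right_inv hz.1] at this
  obtain ⟨c, hcO, hc⟩ := exists_interpolation_nondegenerate hVo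
    (hAs.differentiableOn (by norm_num)) (hps.differentiableOn (by norm_num))
    (fun z => (hψ01 _).1) hAd Metric.isOpen_ball
    ⟨h x, Metric.mem_ball_self (half_pos hε)⟩
  have hcU : ∀ y ∈ U, ‖c - h y‖ ≤ ε := by
    intro y hy
    have h1 : ‖c - h x‖ < ε / 2 := mem_ball_iff_norm.1 hcO
    calc ‖c - h y‖ = ‖(c - h x) + (h x - h y)‖ := by rw [sub_add_sub_cancel]
      _ ≤ ‖c - h x‖ + ‖h x - h y‖ := norm_add_le _ _
      _ ≤ ε := by linarith [hUh y hy]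
  set F' : X → 𝔼 := equivariantInterpolation ρ ψ c F with hF'
  have hF's : ContMDiff (𝓡 N) 𝓘(ℝ, 𝔼) ∞ F' := 
    ContMDiff.equivariantInterpolation hsmooth hψs hF c
  have hF'e : IsEquivariant ρ F' := hFe.equivariantInterpolation ψ c
  have hF'U : ∀ y ∈ U, F' y = F y + ψ y • (c - F y) := fun y hy =>
    equivariantInterpolation_of_mem hU hψmem hy
  set T : Set X := {y | ∃ g : G, g⁻¹ • y ∈ K} with hT
  have hTc : IsClosed T := by
    have : T = ⋃ g : G, (fun y => g⁻¹ • y) ⁻¹' K := by ext y; simp [hT]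
    rw [this]
    exact isClosed_iUnion_of_finite fun g => hKc.isClosed.preimage (hsmooth g⁻¹).continuous
  have hF'T : ∀ y ∉ T, F' y = F y := fun y hy =>
    equivariantInterpolation_of_forall_eq_zero fun g => by
      by_contra hne
      exact hy ⟨g, hψK _ hne⟩
  have hA'V : ∀ z ∈ V, (F' ∘ e.symm) z = A z + p z • (c - A z) := fun z hz => hF'U _ hz.2
  have hA's : ContDiffOn ℝ ∞ (F' ∘ e.symm) V :=
    (hF's.contDiffOn_comp_chart_symm x).mono inter_subset_left
  have hA'd : ∀ z ∈ V, (F' ∘ e.symm) z = 0 → (fderiv ℝ (F' ∘ e.symm) z).det ≠ 0 := by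
    intro z hz h0
    have hloc : F' ∘ e.symm =ᶠ[𝓝 z] fun z => A z + p z • (c - A z) := by
      filter_upwards [hVo.mem_nhds hz] with w hw using hA'V w hw
    rw [hloc.fderiv_eq]
    exact hc z hz ((hA'V z hz).symm.trans h0)
  have hmapV : ∀ y ∈ K, e y ∈ V := fun y hy =>
    ⟨e.map_source (hKs hy), by
      rw [mem_preimage, e.left_inv (hKs hy)]
      exact hψU hy⟩
  have hF'0 : IsRegularValue (𝓡 N) F' 0 := by
    intro y hy
    by_cases hyT : y ∈ T
    · obtain ⟨g, hg⟩ := hyT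
      have hgy : F' (g⁻¹ • y) = 0 := by rw [hF'e, hy, map_zero]
      have hsurj := surjective_mfderiv_smul hsmooth hF's hF'e g
        ((surjective_mfderiv_iff_det_ne_zero hF's x (hKs hg)).2
          (hA'd _ (hmapV _ hg) (by rwa [Function.comp_apply, e.left_inv (hKs hg)])))
      rwa [smul_inv_smul] at hsurj
    · have hloc : F' =ᶠ[𝓝 y] F := by
        filter_upwards [hTc.isOpen_compl.mem_nhds hyT] with w hw using hF'T w hw
      rw [hloc.mfderiv_eq]
      exact hF0 y ((hF'T y hyT).symm.trans hy)
  -- Zeros in the translates of `K` come in `Nat.card G` copies of those in `K`; this factor turns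
  -- parity in the chart into congruence modulo `Nat.card G * 2`. Off `T` the two maps agree.
  have hcount : ∀ Φ : X → 𝔼, ContMDiff (𝓡 N) 𝓘(ℝ, 𝔼) ∞ Φ → IsEquivariant ρ Φ →
      IsRegularValue (𝓡 N) Φ 0 → (Φ ⁻¹' {0}).ncard
        = Nat.card G * {z ∈ e '' K | (Φ ∘ e.symm) z = 0}.ncard + (Φ ⁻¹' {0} \ T).ncard := by
    intro Φ hΦ hΦe hΦ0
    have himg : {z ∈ e '' K | (Φ ∘ e.symm) z = 0} = e '' (Φ ⁻¹' {0} ∩ K) := by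
      ext z
      constructor
      · rintro ⟨⟨y, hy, rfl⟩, h0⟩
        rw [Function.comp_apply, e.left_inv (hKs hy)] at h0
        exact ⟨y, ⟨h0, hy⟩, rfl⟩
      · rintro ⟨y, ⟨h0, hy⟩, rfl⟩
        refine ⟨⟨y, hy, rfl⟩, ?_⟩
        rw [Function.comp_apply, e.left_inv (hKs hy)]
        exact h0
    rw [himg, (e.injOn.mono (inter_subset_right.trans hKs)).ncard_image,
      ← ncard_inter_iUnion_smul (fun g y hy => ?_) hKfree]
    · exact (ncard_inter_add_ncard_sdiff_eq_ncard _ _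
        (finite_zeros_of_isRegularValue hΦ hΦ0)).symm
    · rw [mem_preimage, mem_singleton_iff] at hy ⊢
      rw [hΦe, hy, map_zero]
  have hdiff : F ⁻¹' {0} \ T = F' ⁻¹' {0} \ T := by
    ext y
    simp only [Set.mem_sdiff, mem_preimage, mem_singleton_iff, and_congr_left_iff]
    intro hy
    rw [hF'T y hy]
  refine ⟨F', hF's, hF'e, hF'0, ?_, fun y hy =>
    norm_equivariantInterpolation_sub_le hFe hh hU hψmem hψ01 hcU hy, fun y hy => ?_⟩
  · rw [hcount F hF hFe hF0, hcount F' hF's hF'e hF'0, hdiff]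
    have h2 : (2 : WithTop ℕ∞) ≤ ∞ := WithTop.coe_le_coe.2 (le_top : (2 : ℕ∞) ≤ ⊤)
    refine Nat.ModEq.add_right _ (Nat.ModEq.mul_left' _ ?_)
    refine ncard_zeros_modEq_of_contDiffOn hVo (hAs.of_le h2) (hA's.of_le h2)
      (hKc.image_of_continuousOn (e.continuousOn.mono hKs)) (image_subset_iff.2 hmapV) ?_ hAd hA'd
    rintro z ⟨hz, hzK⟩
    have hψ0 : p z = 0 := by
      by_contra hne
      exact hzK ⟨e.symm z, hψK _ hne, e.right_inv hz.1⟩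
    rw [hA'V z hz, hψ0, zero_smul, add_zero]
  · have hyU : y ∈ U := hψmem y (by rw [hy]; exact one_ne_zero)
    rw [hF'U y hyU, hy, one_smul, add_sub_cancel]
    exact hcU y hyU

/-- An equivariant map with nondegenerate zeros can be moved arbitrarily close to a continuous
equivariant map, keeping the number of zeros modulo twice the order of the group. -/
theorem exists_equivariant_approximation [T2Space X] [CompactSpace X] [IsManifold (𝓡 N) ∞ X]
    [Finite G] (hsmooth : ∀ g : G, ContMDiff (𝓡 N) (𝓡 N) ∞ (fun x : X => g • x))
    (hfree : ∀ x : X, ∀ g : G, g ≠ 1 → g • x ≠ x) {ρ : G →* (𝔼 ≃ₗᵢ[ℝ] 𝔼)}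
    {f h : X → 𝔼} (hf : ContMDiff (𝓡 N) 𝓘(ℝ, 𝔼) ∞ f) (hfe : IsEquivariant ρ f)
    (hf0 : IsRegularValue (𝓡 N) f 0) (hc : Continuous h) (hh : IsEquivariant ρ h) {ε : ℝ}
    (hε : 0 < ε) :
    ∃ F : X → 𝔼, (f ⁻¹' {0}).ncard ≡ (F ⁻¹' {0}).ncard [MOD Nat.card G * 2] ∧
      ∀ y, ‖F y - h y‖ ≤ ε := by
  have hloc : ∀ x : X, ∃ U : Set X, IsOpen U ∧ (∀ g : G, g ≠ 1 → ∀ y ∈ U, g • y ∉ U) ∧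
      (∀ y ∈ U, ‖h x - h y‖ ≤ ε / 2) ∧ ∃ ψ : SmoothBumpFunction (𝓡 N) x, tsupport ψ ⊆ U := by
    intro x
    obtain ⟨W, hW, hWfree⟩ := exists_nhds_smul_notMem (fun g => (hsmooth g).continuous) (hfree x)
    have hball := hc.continuousAt.preimage_mem_nhds (Metric.ball_mem_nhds (h x) (half_pos hε))
    obtain ⟨U, hUsub, hUo, hxU⟩ := mem_nhds_iff.1 (inter_mem hW hball)
    obtain ⟨ψ, -, hψ⟩ := (SmoothBumpFunction.nhds_basis_tsupport (I := 𝓡 N) x).mem_iff.1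
      (hUo.mem_nhds hxU)
    refine ⟨U, hUo, fun g hg y hy hgy => hWfree g hg y (hUsub hy).1 (hUsub hgy).1,
      fun y hy => ?_, ψ, hψ⟩
    rw [← dist_eq_norm, dist_comm]
    exact (Metric.mem_ball.1 (hUsub hy).2).le
  choose U hUo hUfree hUh ψ hψ using hloc
  -- Induction on the finitely many bumps used: each move secures the estimate where its bump equals
  -- `1` and keeps it wherever it already held.
  have key : ∀ t : Finset X, ∃ F : X → 𝔼, ContMDiff (𝓡 N) 𝓘(ℝ, 𝔼) ∞ F ∧ IsEquivariant ρ F ∧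
      IsRegularValue (𝓡 N) F 0 ∧
      (f ⁻¹' {0}).ncard ≡ (F ⁻¹' {0}).ncard [MOD Nat.card G * 2] ∧
      ∀ y, ∀ x ∈ t, ψ x y = 1 → ‖F y - h y‖ ≤ ε := by
    classical
    intro t
    induction t using Finset.induction_on with
    | empty => exact ⟨f, hf, hfe, hf0, rfl, by simp⟩
    | insert x t _ ih =>
      obtain ⟨F, hF, hFe, hF0, hcard, hFt⟩ := ih
      obtain ⟨F', hF', hFe', hF0', hcard', hkeep, hnew⟩ := exists_equivariant_modification hsmooth
        hh (hUo x) (hUfree x) (hψ x) hε (hUh x) hF hFe hF0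
      refine ⟨F', hF', hFe', hF0', hcard.trans hcard', fun y x' hx' hy => ?_⟩
      rcases Finset.mem_insert.1 hx' with rfl | hx't
      · exact hnew y hy
      · exact hkeep y (hFt y x' hx't hy)
  obtain ⟨t, ht⟩ := CompactSpace.elim_nhds_subcover (fun x : X => {y | ψ x y = 1})
    fun x => (ψ x).eventuallyEq_one
  obtain ⟨F, -, -, -, hcard, hFt⟩ := key t
  refine ⟨F, hcard, fun y => ?_⟩
  have hy : y ∈ ⋃ x ∈ t, {y | ψ x y = 1} := ht ▸ mem_univ y
  simp only [mem_iUnion, mem_ofPred_eq, exists_prop] at hy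
  obtain ⟨x, hx, hxy⟩ := hy
  exact hFt y x hx hxy

end Main

theorem theorem2p1 {N : ℕ}
    {X : Type*} [TopologicalSpace X] [T2Space X] [CompactSpace X] [ConnectedSpace X]
    [ChartedSpace (EuclideanSpace ℝ (Fin N)) X] [IsManifold (𝓡 N) ∞ X]
    {G : Type*} [Group G] [Finite G] [MulAction G X]
    -- the action of `G` on `X` is smooth
    (hsmooth : ∀ g : G, ContMDiff (𝓡 N) (𝓡 N) ∞ (fun x : X => g • x))
    -- the action of `G` on `X` is free: each orbit has exactly `#G` points
    (hfree : ∀ x : X, (MulAction.orbit G x).ncard = Nat.card G)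
    -- an action of `G` on `ℝ^N` by linear isometries
    (ρ : G →* (EuclideanSpace ℝ (Fin N) ≃ₗᵢ[ℝ] EuclideanSpace ℝ (Fin N)))
    (hf : ∃ f : X → EuclideanSpace ℝ (Fin N),
      ContMDiff (𝓡 N) 𝓘(ℝ, EuclideanSpace ℝ (Fin N)) ∞ f ∧
      IsEquivariant ρ f ∧
      IsRegularValue (𝓡 N) f 0 ∧
      ∃ x₀ : X, f ⁻¹' {0} = MulAction.orbit G x₀)
    (h : X → EuclideanSpace ℝ (Fin N)) (hcont : Continuous h) (hequiv : IsEquivariant ρ h) :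
    ∃ x : X, h x = 0 := by
  by_contra! hne
  obtain ⟨f, hfs, hfe, hf0, x₀, hx₀⟩ := hf
  obtain ⟨δ, hδ, hδh⟩ : ∃ δ > 0, ∀ x ∈ (univ : Set X), δ ≤ ‖h x‖ :=
    isCompact_univ.exists_forall_le' hcont.norm.continuousOn fun x _ => norm_pos_iff.2 (hne x)
  obtain ⟨F, hcard, hF⟩ := exists_equivariant_approximation hsmooth
    (fun x g hg => smul_ne_of_ncard_orbit (hfree x) hg) hfs hfe hf0 hcont hequiv (half_pos hδ)
  have hempty : F ⁻¹' {0} = ∅ := by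
    refine eq_empty_of_forall_notMem fun y hy => ?_
    have h1 := hF y
    rw [mem_preimage, mem_singleton_iff] at hy
    rw [hy, zero_sub, norm_neg] at h1
    linarith [hδh y (mem_univ y)]
  -- The congruence now says that `Nat.card G * 2` divides `Nat.card G`, which is positive.
  rw [hempty, ncard_empty, hx₀, hfree, Nat.modEq_zero_iff_dvd] at hcard
  have hpos : 0 < Nat.card G := Nat.card_pos
  have := Nat.le_of_dvd hpos hcard
  omega
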